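/- Let $S$ be a finite set and let $b:2^S\to\mathbb{Z}\cup\{+\infty\}$ be a submodular function, that is, $b(\emptyset)=0$ and $b(X)+b(Y)\ge b(X\cap Y)+b(X\cup Y)$ for all $X,Y\subseteq S$ with $b(X),b(Y)$ finite; assume that $b(S)$ is finite. Let $$B=\Big\{x\in\mathbb{R}^S:\ \sum_{s\in S}x(s)=b(S),\quad \sum_{s\in Z}x(s)\le b(Z)\ \text{ for every } Z\subset S\Big\}$$ be the associated integral base-polyhedron (by convention $B=\emptyset$ is also an integral base-polyhedron). For $\xi\in\mathbb{R}$ put $$\overline{\varphi}(\xi)=(2k+1)|\xi|-k(k+1),\qquad k=\lfloor|\xi|\rfloor,$$ which is the piecewise-linear extension of $k\mapsto k^2$ from $\mathbb{Z}$ to $\mathbb{R}$, and let $\overline{W}(x)=\sum_{s\in S}\overline{\varphi}(x(s))$ for $x\in\mathbb{R}^S$. An element of a set of vectors is called decreasingly minimal (dec-min) in that set if its sequence of components, arranged in decreasing order, is lexicographically smallest among those of all elements of the set. Theorem 4.3. For any minimizer $x_{\mathbb{R}}$ of $\overline{W}$ over $B$, there exists a dec-min element $m_{\mathbb{Z}}$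 of the M-convex set $B\cap\mathbb{Z}^S$ satisfying $$\lfloor x_{\mathbb{R}}\rfloor\le m_{\mathbb{Z}}\le\lceil x_{\mathbb{R}}\rceil,$$ where rounding and inequalities are componentwise. -/

import Mathlib

namespace DecMin

/-- A set-function `b` with values in `ℝ ∪ {+∞}` is submodular: `b ∅ = 0`, and the submodular
inequality holds for all pairs of sets with finite values. -/
def IsSubmodular {S : Type*} [DecidableEq S] (b : Finset S → WithTop ℝ) : Prop :=
  b ∅ = 0 ∧ ∀ X Y : Finset S, b X ≠ ⊤ → b Y ≠ ⊤ → b (X ∩ Y) + b (X ∪ Y) ≤ b X + b Y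

/-- Each finite value of `b` is an integer. -/
def IsIntegerValued {S : Type*} (b : Finset S → WithTop ℝ) : Prop :=
  ∀ X : Finset S, b X = ⊤ ∨ ∃ k : ℤ, b X = ((k : ℝ) : WithTop ℝ)

/-- `B(b) = {x ∈ ℝ^S : x(S) = b(S), x(Z) ≤ b(Z) for all Z ⊆ S}`. -/
def basePolyhedron {S : Type*} [Fintype S] (b : Finset S → WithTop ℝ) : Set (S → ℝ) :=
  {x | ((∑ s, x s : ℝ) : WithTop ℝ) = b Finset.univ ∧
    ∀ Z : Finset S, ((∑ s ∈ Z, x s : ℝ) : WithTop ℝ) ≤ b Z}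

/-- An integral base-polyhedron: the base-polyhedron of an integer-valued submodular function that
is finite on the ground-set, or, by convention, the empty set. -/
def IsIntegralBasePolyhedron {S : Type*} [Fintype S] [DecidableEq S] (B : Set (S → ℝ)) : Prop :=
  B = ∅ ∨ ∃ b : Finset S → WithTop ℝ,
    IsSubmodular b ∧ IsIntegerValued b ∧ b Finset.univ ≠ ⊤ ∧ B = basePolyhedron b

/-- The set `B ∩ ℤ^S` of integral elements of `B`. -/
def integralPoints {S : Type*} (B : Set (S → ℝ)) : Set (S → ℤ) :=
  {z | (fun s => (z s : ℝ)) ∈ B}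

/-- The components of `x`, listed in decreasing order with multiplicity. -/
def sortedDecreasing {S α : Type*} [Fintype S] [LinearOrder α] (x : S → α) : List α :=
  (Finset.univ.val.map x).sort (fun a b => a ≥ b)

/-- `m` is a decreasingly minimal element of `Q`: among the elements of `Q`, its decreasingly
ordered component sequence is lexicographically smallest. -/
def IsDecMin {S α : Type*} [Fintype S] [LinearOrder α] (Q : Set (S → α)) (m : S → α) : Prop :=
  m ∈ Q ∧ ∀ y ∈ Q, ¬ List.Lex (fun a b => a < b) (sortedDecreasing y) (sortedDecreasing m)

/-- The piecewise-linear extension of `k ↦ k ^ 2` from the integers to the reals. -/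
noncomputable def phiBar (ξ : ℝ) : ℝ :=
  (2 * (⌊|ξ|⌋ : ℝ) + 1) * |ξ| - (⌊|ξ|⌋ : ℝ) * ((⌊|ξ|⌋ : ℝ) + 1)

/-- The piecewise-linear extension of the square-sum. -/
noncomputable def wBar {S : Type*} [Fintype S] (x : S → ℝ) : ℝ :=
  ∑ s, phiBar (x s)

end DecMin

namespace DecMin

open Filter Topology

/-! ### One-sided slopes of the separable objective. -/

section PhiBar

/-! The slope of `phiBar` jumps at each integer `k`, so a minimizer `x` admits no exchange raising a
coordinate below `k` and lowering one above `k`. Uncrossing the tight sets that block these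
exchanges gives one tight set `Z` with `x ≤ k` on `Z` and `x ≥ k` off it
(`exists_isTight_level_set`). An extreme point `z` of the face of `x`, cut by the box from `⌊x⌋` to
`⌈x⌉`, is integral and keeps every such `Z` tight (`exists_integral_rounding`); rounding does not
cross the integer `k`. Hence `z` minimizes `∑ (z s - k)⁺` over the integral points for every `k` at
once, which rules out a lexicographically smaller competitor. -/

theorem phiBar_neg (ξ : ℝ) : phiBar (-ξ) = phiBar ξ := by
  simp [phiBar]

theorem phiBar_eq_of_mem_Icc_of_nonneg (k : ℤ) (hk : 0 ≤ k) (ξ : ℝ) (h1 : (k : ℝ) ≤ ξ)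
    (h2 : ξ ≤ k + 1) : phiBar ξ = (2 * k + 1) * ξ - k * (k + 1) := by
  have hk' : (0 : ℝ) ≤ k := by exact_mod_cast hk
  have habs : |ξ| = ξ := abs_of_nonneg (hk'.trans h1)
  rcases h2.lt_or_eq with h | h
  · have hf : ⌊ξ⌋ = k := Int.floor_eq_iff.2 ⟨h1, h⟩
    rw [phiBar, habs, hf]
  · have hf : ⌊ξ⌋ = k + 1 := by
      rw [h]
      exact_mod_cast Int.floor_intCast (R := ℝ) (k + 1)
    rw [phiBar, habs, hf, h]
    push_cast
    ring

theorem phiBar_eq_of_mem_Icc (k : ℤ) (ξ : ℝ) (h1 : (k : ℝ) ≤ ξ) (h2 : ξ ≤ k + 1) :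
    phiBar ξ = (2 * k + 1) * ξ - k * (k + 1) := by
  rcases le_or_gt 0 k with hk | hk
  · exact phiBar_eq_of_mem_Icc_of_nonneg k hk ξ h1 h2
  · rw [← phiBar_neg, phiBar_eq_of_mem_Icc_of_nonneg (-k - 1) (by omega) (-ξ)
      (by push_cast; linarith) (by push_cast; linarith)]
    push_cast
    ring

/-- The right slope at `a` is `2⌊a⌋ + 1`, and `⌊a⌋ + 1 ≤ k` because `k` is an integer. -/
theorem eventually_phiBar_add (k : ℤ) (a : ℝ) (ha : a < k) :
    ∀ᶠ ε in 𝓝[>] (0 : ℝ), phiBar (a + ε) - phiBar a ≤ (2 * k - 1) * ε := by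
  have h1 : ∀ᶠ ε in 𝓝[>] (0 : ℝ), a + ε < ⌊a⌋ + 1 := by
    apply Filter.Eventually.filter_mono nhdsWithin_le_nhds
    have : Tendsto (fun ε : ℝ => a + ε) (𝓝 0) (𝓝 (a + 0)) := by
      exact (continuous_const.add continuous_id).tendsto 0
    rw [add_zero] at this
    exact this.eventually_lt_const (Int.lt_floor_add_one a)
  filter_upwards [h1, self_mem_nhdsWithin] with ε h1 (h0 : 0 < ε)
  have hf := Int.floor_le a
  have hk : (⌊a⌋ : ℝ) + 1 ≤ k := by exact_mod_cast Int.floor_lt.2 ha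
  rw [phiBar_eq_of_mem_Icc ⌊a⌋ (a + ε) (by linarith) h1.le,
    phiBar_eq_of_mem_Icc ⌊a⌋ a hf (Int.lt_floor_add_one a).le]
  nlinarith

theorem eventually_phiBar_sub (k : ℤ) (a : ℝ) (ha : k < a) :
    ∀ᶠ ε in 𝓝[>] (0 : ℝ), phiBar (a - ε) - phiBar a ≤ -((2 * k + 1) * ε) := by
  filter_upwards [eventually_phiBar_add (-k) (-a) (by push_cast; linarith)] with ε h
  rw [phiBar_neg, ← phiBar_neg, show -(-a + ε) = a - ε by ring] at h
  push_cast at h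
  linarith

end PhiBar

/-! ### Tight sets, exchanges and integral rounding. -/

section Tight

variable {S : Type*} [Fintype S] [DecidableEq S] {b : Finset S → WithTop ℝ} {x : S → ℝ}

/-- A set is tight for `x` if its defining inequality holds with equality at `x`. -/
def IsTight (b : Finset S → WithTop ℝ) (x : S → ℝ) (Z : Finset S) : Prop :=
  b Z = ((∑ s ∈ Z, x s : ℝ) : WithTop ℝ)

omit [Fintype S] in
theorem isTight_inter_and_union_of_le (hb : IsSubmodular b)
    (hx : ∀ Z : Finset S, ((∑ s ∈ Z, x s : ℝ) : WithTop ℝ) ≤ b Z) {X Y : Finset S}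
    (hX : IsTight b x X) (hY : IsTight b x Y) :
    IsTight b x (X ∩ Y) ∧ IsTight b x (X ∪ Y) := by
  have h := hb.2 X Y (by rw [hX]; exact WithTop.coe_ne_top) (by rw [hY]; exact WithTop.coe_ne_top)
  have hi := hx (X ∩ Y)
  have hu := hx (X ∪ Y)
  have hsum : ∑ s ∈ X ∪ Y, x s + ∑ s ∈ X ∩ Y, x s = ∑ s ∈ X, x s + ∑ s ∈ Y, x s :=
    Finset.sum_union_inter
  unfold IsTight at *
  rw [hX, hY] at h
  cases hbi : b (X ∩ Y) with
  | top => rw [hbi, ← WithTop.coe_add, top_add] at h; simp at h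
  | coe p =>
    cases hbu : b (X ∪ Y) with
    | top => rw [hbu, ← WithTop.coe_add, add_top] at h; simp at h
    | coe q =>
      rw [hbi] at h hi
      rw [hbu] at h hu
      norm_cast at h hi hu ⊢
      constructor <;> linarith

theorem IsTight.inter (hb : IsSubmodular b) (hx : x ∈ basePolyhedron b) {X Y : Finset S}
    (hX : IsTight b x X) (hY : IsTight b x Y) : IsTight b x (X ∩ Y) :=
  (isTight_inter_and_union_of_le hb hx.2 hX hY).1

theorem IsTight.union (hb : IsSubmodular b) (hx : x ∈ basePolyhedron b) {X Y : Finset S}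
    (hX : IsTight b x X) (hY : IsTight b x Y) : IsTight b x (X ∪ Y) :=
  (isTight_inter_and_union_of_le hb hx.2 hX hY).2

omit [DecidableEq S] in
theorem isTight_univ (hx : x ∈ basePolyhedron b) : IsTight b x Finset.univ := hx.1.symm

omit [Fintype S] in
theorem isTight_empty (hb : IsSubmodular b) : IsTight b x ∅ := by
  simp [IsTight, hb.1]

omit [DecidableEq S] in
theorem eventually_add_smul_mem_basePolyhedron (hx : x ∈ basePolyhedron b) (d : S → ℝ)
    (hd : ∑ s, d s = 0) (hZ : ∀ Z, IsTight b x Z → ∑ s ∈ Z, d s ≤ 0) :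
    ∀ᶠ ε in 𝓝[>] (0 : ℝ), x + ε • d ∈ basePolyhedron b := by
  have hsum : ∀ (ε : ℝ) (Z : Finset S),
      ∑ s ∈ Z, (x + ε • d) s = ∑ s ∈ Z, x s + ε * ∑ s ∈ Z, d s := by
    intro ε Z
    simp [Finset.sum_add_distrib, Finset.mul_sum]
  have key : ∀ Z : Finset S, ∀ᶠ ε in 𝓝[>] (0 : ℝ),
      ((∑ s ∈ Z, (x + ε • d) s : ℝ) : WithTop ℝ) ≤ b Z := by
    intro Z
    have hle := hx.2 Z
    have ht := hZ Z
    unfold IsTight at ht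
    cases hbZ : b Z with
    | top => simp
    | coe p =>
      rw [hbZ] at hle ht
      norm_cast at hle ht
      simp only [WithTop.coe_le_coe, hsum]
      rcases hle.lt_or_eq with h | h
      · have hc : Tendsto (fun ε : ℝ => ∑ s ∈ Z, x s + ε * ∑ s ∈ Z, d s) (𝓝 0)
            (𝓝 (∑ s ∈ Z, x s + 0 * ∑ s ∈ Z, d s)) :=
          (continuous_const.add (continuous_id.mul continuous_const)).tendsto 0
        rw [zero_mul, add_zero] at hc
        exact ((hc.eventually_lt_const h).mono fun _ h => h.le).filter_mono nhdsWithin_le_nhds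
      · filter_upwards [self_mem_nhdsWithin] with ε (hε : 0 < ε)
        have := mul_nonpos_of_nonneg_of_nonpos hε.le (ht h.symm)
        linarith
  filter_upwards [eventually_all.2 key] with ε hε
  refine ⟨?_, hε⟩
  rw [hsum, hd, mul_zero, add_zero]
  exact hx.1

omit [Fintype S] in
theorem sum_single_sub_single (s t : S) (Z : Finset S) :
    ∑ u ∈ Z, (Pi.single s 1 - Pi.single t 1 : S → ℝ) u
      = (if s ∈ Z then 1 else 0) - (if t ∈ Z then 1 else 0) := by
  simp [Finset.sum_sub_distrib]

/-- Otherwise a small step `ε` from `t` to `s` stays feasible and changes `wBar` by at most `(2k -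
1)ε - (2k + 1)ε < 0`. -/
theorem exists_isTight_separating (hx : x ∈ basePolyhedron b)
    (hmin : ∀ y ∈ basePolyhedron b, wBar x ≤ wBar y) {k : ℤ} {s t : S}
    (hs : x s < k) (ht : k < x t) : ∃ Z, IsTight b x Z ∧ s ∈ Z ∧ t ∉ Z := by
  by_contra! hno
  have hst : s ≠ t := by
    rintro rfl
    exact lt_asymm hs ht
  have hB := eventually_add_smul_mem_basePolyhedron hx (Pi.single s 1 - Pi.single t 1)
    (by rw [sum_single_sub_single]; simp) (fun Z hZ => by
      rw [sum_single_sub_single]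
      by_cases h : s ∈ Z
      · simp [h, hno Z hZ h]
      · by_cases h' : t ∈ Z <;> simp [h, h'])
  obtain ⟨ε, hεB, hεs, hεt, hε⟩ := (hB.and ((eventually_phiBar_add k _ hs).and
    ((eventually_phiBar_sub k _ ht).and self_mem_nhdsWithin))).exists
  have hε : 0 < ε := hε
  have hw := hmin _ hεB
  have hpt : ∀ u, phiBar ((x + ε • (Pi.single s 1 - Pi.single t 1 : S → ℝ)) u) - phiBar (x u)
      = (Pi.single s (phiBar (x s + ε) - phiBar (x s)) : S → ℝ) u
        + (Pi.single t (phiBar (x t - ε) - phiBar (x t)) : S → ℝ) u := by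
    intro u
    by_cases hus : u = s
    · subst hus
      simp [hst]
    · by_cases hut : u = t
      · subst hut
        simp [hus, sub_eq_add_neg]
      · simp [hus, hut]
  have hdiff := Finset.sum_congr (rfl : (Finset.univ : Finset S) = Finset.univ)
    (fun u _ => hpt u)
  rw [Finset.sum_sub_distrib, Finset.sum_add_distrib] at hdiff
  simp only [Finset.sum_pi_single', Finset.mem_univ, if_true] at hdiff
  unfold wBar at hw
  nlinarith

theorem exists_isTight_level_set (hb : IsSubmodular b) (hx : x ∈ basePolyhedron b)
    (hmin : ∀ y ∈ basePolyhedron b, wBar x ≤ wBar y) (k : ℤ) :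
    ∃ Z, IsTight b x Z ∧ (∀ s ∈ Z, x s ≤ k) ∧ ∀ s ∉ Z, k ≤ x s := by
  have hsep : ∀ s t, ∃ Z, IsTight b x Z ∧ (x s < k → k < x t → s ∈ Z ∧ t ∉ Z) := by
    intro s t
    by_cases h : x s < k ∧ k < x t
    · obtain ⟨Z, hZ, hZ'⟩ := exists_isTight_separating hx hmin h.1 h.2
      exact ⟨Z, hZ, fun _ _ => hZ'⟩
    -- Pairs needing no separation get the whole ground set as a dummy value.
    · exact ⟨_, isTight_univ hx, fun h1 h2 => absurd ⟨h1, h2⟩ h⟩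
  choose Z hZ hZs using hsep
  -- For each low `s`, intersect over all high `t`, then take the union over `s`; the lattice
  -- property keeps this tight.
  refine ⟨(Finset.univ.filter fun s => x s < k).sup fun s =>
    (Finset.univ.filter fun t => k < x t).inf (Z s), ?_, ?_, ?_⟩
  · refine Finset.sup_induction (isTight_empty hb) (fun _ h _ h' => h.union hb hx h') ?_
    intro s _
    exact Finset.inf_induction (isTight_univ hx) (fun _ h _ h' => h.inter hb hx h')
      (fun t _ => hZ s t)
  · intro t ht
    by_contra! hkt
    obtain ⟨s, hs, hts⟩ := Finset.mem_sup.1 ht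
    have : t ∈ Z s t := (Finset.inf_le (by simpa using hkt) : _ ≤ Z s t) hts
    exact (hZs s t (by simpa using hs) hkt).2 this
  · intro s hs
    by_contra! hsk
    refine hs (Finset.mem_sup.2 ⟨s, by simpa using hsk, ?_⟩)
    have : ({s} : Finset S) ≤ (Finset.univ.filter fun t => k < x t).inf (Z s) :=
      Finset.le_inf fun t ht =>
        Finset.singleton_subset_iff.2 (hZs s t hsk (by simpa using ht)).1
    exact Finset.singleton_subset_iff.1 this

/-- Take a smallest tight set `D` with a nonintegral coordinate. As its total is an integer, it has
at least two. By minimality, a tight set containing one of them contains all of `D`. -/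
theorem exists_exchangeable_nonintegral (hb : IsSubmodular b) (hbi : IsIntegerValued b)
    (hx : x ∈ basePolyhedron b) {u : S} (hu : x u ∉ Set.range ((↑) : ℤ → ℝ)) :
    ∃ s t, s ≠ t ∧ x s ∉ Set.range ((↑) : ℤ → ℝ) ∧ x t ∉ Set.range ((↑) : ℤ → ℝ) ∧
      ∀ Z, IsTight b x Z → (s ∈ Z ↔ t ∈ Z) := by
  classical
  obtain ⟨D, hD, hDmin⟩ := Finset.exists_min_image
    (Finset.univ.filter fun D : Finset S =>
      IsTight b x D ∧ ∃ s ∈ D, x s ∉ Set.range ((↑) : ℤ → ℝ)) Finset.card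
    ⟨Finset.univ, by simpa using ⟨isTight_univ hx, u, by simpa using hu⟩⟩
  simp only [Finset.mem_filter, Finset.mem_univ, true_and] at hD hDmin
  obtain ⟨hDt, s, hsD, hs⟩ := hD
  have hsub : ∀ Z, IsTight b x Z → ∀ v ∈ D, v ∈ Z → x v ∉ Set.range ((↑) : ℤ → ℝ) → D ⊆ Z := by
    intro Z hZ v hvD hvZ hv
    have := hDmin (Z ∩ D) ⟨hZ.inter hb hx hDt, v, Finset.mem_inter.2 ⟨hvZ, hvD⟩, hv⟩
    exact Finset.inter_eq_right.1 (Finset.eq_of_subset_of_card_le Finset.inter_subset_right this)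
  obtain ⟨t, htD, hts, ht⟩ : ∃ t ∈ D, t ≠ s ∧ x t ∉ Set.range ((↑) : ℤ → ℝ) := by
    by_contra! hall
    obtain ⟨k, hk⟩ : ∃ k : ℤ, (∑ v ∈ D, x v : ℝ) = k := by
      rcases hbi D with h | ⟨k, h⟩
      · rw [hDt] at h
        exact absurd h WithTop.coe_ne_top
      · rw [hDt] at h
        exact ⟨k, WithTop.coe_injective h⟩
    have hrest : ∑ v ∈ D.erase s, x v ∈ (Int.castAddHom ℝ).range :=
      sum_mem fun v hv => hall v (Finset.mem_of_mem_erase hv) (Finset.ne_of_mem_erase hv)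
    obtain ⟨l, hl⟩ := hrest
    rw [← Finset.add_sum_erase D x hsD] at hk
    simp only [Int.coe_castAddHom] at hl
    exact hs ⟨k - l, by push_cast; linarith⟩
  exact ⟨s, t, hts.symm, hs, ht, fun Z hZ =>
    ⟨fun h => hsub Z hZ s hsD h hs htD, fun h => hsub Z hZ t htD h ht hsD⟩⟩

omit [DecidableEq S] in
theorem isClosed_basePolyhedron (b : Finset S → WithTop ℝ) : IsClosed (basePolyhedron b) := by
  have hset : basePolyhedron b = {x | ((∑ s, x s : ℝ) : WithTop ℝ) = b Finset.univ} ∩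
      ⋂ Z : Finset S, {x | ((∑ s ∈ Z, x s : ℝ) : WithTop ℝ) ≤ b Z} := by
    ext x
    simp [basePolyhedron]
  rw [hset]
  refine IsClosed.inter ?_ (isClosed_iInter fun Z => ?_)
  · cases b Finset.univ with
    | top => simp
    | coe p =>
      simp only [WithTop.coe_inj]
      exact isClosed_eq (by fun_prop) continuous_const
  · cases b Z with
    | top => simp
    | coe p =>
      simp only [WithTop.coe_le_coe]
      exact isClosed_le (by fun_prop) continuous_const

theorem eventually_add_smul_mem_Icc_of_ne {a : ℝ} (x lo hi : S → ℝ) (hx : x ∈ Set.Icc lo hi)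
    {s t : S} (hs : x s ≠ lo s ∧ x s ≠ hi s) (ht : x t ≠ lo t ∧ x t ≠ hi t) :
    ∀ᶠ ε in 𝓝[>] (0 : ℝ),
      x + ε • (a • (Pi.single s 1 - Pi.single t 1 : S → ℝ)) ∈ Set.Icc lo hi := by
  have key : ∀ u, ∀ᶠ ε in 𝓝[>] (0 : ℝ),
      (x + ε • (a • (Pi.single s 1 - Pi.single t 1 : S → ℝ))) u ∈ Set.Icc (lo u) (hi u) := by
    intro u
    by_cases hu : u = s ∨ u = t
    · have hlt : lo u < x u ∧ x u < hi u := by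
        rcases hu with rfl | rfl
        · exact ⟨(hx.1 _).lt_of_ne hs.1.symm, (hx.2 _).lt_of_ne hs.2⟩
        · exact ⟨(hx.1 _).lt_of_ne ht.1.symm, (hx.2 _).lt_of_ne ht.2⟩
      have hc : Tendsto (fun ε : ℝ => (x + ε • (a • (Pi.single s 1 - Pi.single t 1 : S → ℝ))) u)
          (𝓝 0) (𝓝 ((x + (0 : ℝ) • (a • (Pi.single s 1 - Pi.single t 1 : S → ℝ))) u)) := by
        apply Continuous.tendsto (f := fun ε : ℝ =>
          (x + ε • (a • (Pi.single s 1 - Pi.single t 1 : S → ℝ))) u)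
        simp only [Pi.add_apply, Pi.smul_apply]
        fun_prop
      rw [zero_smul, add_zero] at hc
      exact (hc.eventually (Icc_mem_nhds hlt.1 hlt.2)).filter_mono nhdsWithin_le_nhds
    · push Not at hu
      refine Eventually.of_forall fun ε => ?_
      simpa [hu.1, hu.2] using And.intro (hx.1 u) (hx.2 u)
  filter_upwards [eventually_all.2 key] with ε hε
  exact ⟨fun u => (hε u).1, fun u => (hε u).2⟩

theorem exists_integral_rounding (hb : IsSubmodular b) (hbi : IsIntegerValued b)
    (hx : x ∈ basePolyhedron b) :
    ∃ z : S → ℤ, (fun s => (z s : ℝ)) ∈ basePolyhedron b ∧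
      (∀ s, ⌊x s⌋ ≤ z s ∧ z s ≤ ⌈x s⌉) ∧
      ∀ Z, IsTight b x Z → IsTight b (fun s => (z s : ℝ)) Z := by
  set lo : S → ℝ := fun s => ⌊x s⌋ with hlo
  set hi : S → ℝ := fun s => ⌈x s⌉ with hhi
  -- The box supplies compactness, hence an extreme point; the equations preserve tightness.
  set C : Set (S → ℝ) := Set.Icc lo hi ∩ (basePolyhedron b ∩
    ⋂ Z ∈ {Z | IsTight b x Z}, {y | ∑ s ∈ Z, y s = ∑ s ∈ Z, x s}) with hC
  have hCc : IsCompact C := isCompact_Icc.inter_right <|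
    (isClosed_basePolyhedron b).inter <| isClosed_biInter fun Z _ =>
      isClosed_eq (by fun_prop) continuous_const
  have hxC : x ∈ C := ⟨⟨fun s => Int.floor_le _, fun s => Int.le_ceil _⟩, hx, by simp⟩
  obtain ⟨y, hy⟩ := hCc.extremePoints_nonempty ⟨x, hxC⟩
  obtain ⟨hyC, hyext⟩ := mem_extremePoints.1 hy
  have hyT : ∀ Z, IsTight b x Z → ∑ s ∈ Z, y s = ∑ s ∈ Z, x s := by
    simpa using hyC.2.2
  have hyTight : ∀ Z, IsTight b x Z → IsTight b y Z := fun Z hZ => by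
    rw [IsTight, hyT Z hZ]
    exact hZ
  have hint : ∀ u, y u ∈ Set.range ((↑) : ℤ → ℝ) := by
    intro u
    by_contra hu
    obtain ⟨s, t, hst, hs, ht, hZ⟩ := exists_exchangeable_nonintegral hb hbi hyC.2.1 hu
    have hd : ∀ (a : ℝ) (Z), IsTight b y Z →
        ∑ u ∈ Z, (a • (Pi.single s 1 - Pi.single t 1 : S → ℝ)) u = 0 := by
      intro a Z hZt
      simp only [Pi.smul_apply, ← Finset.smul_sum]
      rw [sum_single_sub_single]
      simp [hZ Z hZt]
    have hne : ∀ v, y v ∉ Set.range ((↑) : ℤ → ℝ) → y v ≠ lo v ∧ y v ≠ hi v := fun v hv =>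
      ⟨fun h => hv ⟨_, h.symm⟩, fun h => hv ⟨_, h.symm⟩⟩
    have hmem : ∀ a : ℝ, ∀ᶠ ε in 𝓝[>] (0 : ℝ),
        y + ε • (a • (Pi.single s 1 - Pi.single t 1 : S → ℝ)) ∈ C := by
      intro a
      filter_upwards [eventually_add_smul_mem_basePolyhedron hyC.2.1
          (a • (Pi.single s 1 - Pi.single t 1 : S → ℝ)) (hd a _ (isTight_univ hyC.2.1))
          (fun Z hZ => (hd a Z hZ).le),
        eventually_add_smul_mem_Icc_of_ne (a := a) y lo hi hyC.1 (hne s hs) (hne t ht)]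
        with ε h1 h2
      refine ⟨h2, h1, Set.mem_iInter₂.2 fun Z hZ => ?_⟩
      have h0 := hd a Z (hyTight Z hZ)
      change ∑ v ∈ Z, (y v + ε • (a • (Pi.single s 1 - Pi.single t 1 : S → ℝ)) v) = _
      rw [Finset.sum_add_distrib, ← Finset.smul_sum, h0, smul_zero, add_zero, hyT Z hZ]
    -- The exchange is feasible in both directions, so `y` is the midpoint of a proper segment in
    -- `C`.
    obtain ⟨ε, h1, h2, hε⟩ := ((hmem 1).and ((hmem (-1)).and self_mem_nhdsWithin)).exists
    have hε : 0 < ε := hε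
    have heq := (hyext _ h1 _ h2 ⟨1 / 2, 1 / 2, by norm_num, by norm_num, by norm_num, by
      module⟩)
    have := congrFun heq.1 s
    simp [hst, hε.ne'] at this
  choose z hz using hint
  have hzy : (fun s => (z s : ℝ)) = y := funext hz
  refine ⟨z, hzy ▸ hyC.2.1, fun s => ⟨?_, ?_⟩, fun Z hZ => hzy ▸ hyTight Z hZ⟩
  · have : (⌊x s⌋ : ℝ) ≤ y s := hyC.1.1 s
    rw [← hz s] at this
    exact_mod_cast this
  · have : y s ≤ (⌈x s⌉ : ℝ) := hyC.1.2 s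
    rw [← hz s] at this
    exact_mod_cast this

end Tight

/-! ### From positive-part sums to lexicographic order. -/

section Majorization

theorem exists_sum_posPart_lt_of_lex {L M : List ℤ} (h : List.Lex (fun a b => a < b) L M)
    (hlen : L.length = M.length) (hL : L.Pairwise (fun a b => a ≥ b)) :
    ∃ k : ℤ, (L.map fun a => max (a - k) 0).sum < (M.map fun a => max (a - k) 0).sum := by
  induction h with
  | nil => simp at hlen
  | cons _ ih =>
    obtain ⟨k, hk⟩ := ih (by simpa using hlen) (List.pairwise_cons.1 hL).2
    exact ⟨k, by simpa using hk⟩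
  | @rel a L c M hac =>
    -- The threshold is the smaller entry at the first difference: since `L` is sorted, nothing from
    -- there on exceeds it, whereas `c` does.
    refine ⟨a, ?_⟩
    have h0 : (L.map fun e => max (e - a) 0).sum = 0 := by
      apply List.sum_eq_zero
      intro e he
      obtain ⟨f, hf, rfl⟩ := List.mem_map.1 he
      have := (List.pairwise_cons.1 hL).1 f hf
      exact max_eq_right (by omega)
    have h1 : 0 ≤ (M.map fun e => max (e - a) 0).sum := by
      apply List.sum_nonneg
      intro e he
      obtain ⟨f, _, rfl⟩ := List.mem_map.1 he
      exact le_max_right _ _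
    have h2 : 0 < max (c - a) 0 := lt_max_of_lt_left (by omega)
    simp only [List.map_cons, List.sum_cons, sub_self, max_self, h0]
    omega

theorem sum_map_sortedDecreasing {S : Type*} [Fintype S] (z : S → ℤ) (f : ℤ → ℤ) :
    ((sortedDecreasing z).map f).sum = ∑ s, f (z s) := by
  rw [← Multiset.sum_coe, ← Multiset.map_coe, sortedDecreasing, Multiset.sort_eq,
    Multiset.map_map]
  rfl

theorem not_lex_sortedDecreasing_of_sum_posPart_le {S : Type*} [Fintype S] {y z : S → ℤ}
    (h : ∀ k : ℤ, ∑ s, max (z s - k) 0 ≤ ∑ s, max (y s - k) 0) :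
    ¬ List.Lex (fun a b => a < b) (sortedDecreasing y) (sortedDecreasing z) := by
  intro hlex
  obtain ⟨k, hk⟩ := exists_sum_posPart_lt_of_lex hlex (by simp [sortedDecreasing])
    (Multiset.pairwise_sort _ _)
  rw [sum_map_sortedDecreasing, sum_map_sortedDecreasing] at hk
  exact absurd (h k) (not_le.2 hk)

/-- Only `Zᶜ` contributes for `z`. Tightness makes the total of `z` on `Z` maximal, so with equal
grand totals its total on `Zᶜ` is minimal. -/
theorem sum_posPart_le_of_isTight {S : Type*} [Fintype S] [DecidableEq S]
    {b : Finset S → WithTop ℝ} {y z : S → ℤ} (hy : (fun s => (y s : ℝ)) ∈ basePolyhedron b)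
    (hz : (fun s => (z s : ℝ)) ∈ basePolyhedron b) (k : ℤ) {Z : Finset S}
    (hZ : IsTight b (fun s => (z s : ℝ)) Z) (hle : ∀ s ∈ Z, z s ≤ k) (hge : ∀ s ∉ Z, k ≤ z s) :
    ∑ s, max (z s - k) 0 ≤ ∑ s, max (y s - k) 0 := by
  have hyZ : ∑ s ∈ Z, y s ≤ ∑ s ∈ Z, z s := by
    have h := hy.2 Z
    rw [hZ] at h
    have h' : ∑ s ∈ Z, (y s : ℝ) ≤ ∑ s ∈ Z, (z s : ℝ) := WithTop.coe_le_coe.1 h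
    exact_mod_cast h'
  have htot : ∑ s, y s = ∑ s, z s := by
    have h : ∑ s, (y s : ℝ) = ∑ s, (z s : ℝ) := WithTop.coe_injective (hy.1.trans hz.1.symm)
    exact_mod_cast h
  rw [← Finset.sum_add_sum_compl Z, ← Finset.sum_add_sum_compl Z] at htot
  calc ∑ s, max (z s - k) 0
      = ∑ s ∈ Zᶜ, (z s - k) := by
        rw [← Finset.sum_add_sum_compl Z, Finset.sum_eq_zero fun s hs =>
          max_eq_right (sub_nonpos.2 (hle s hs)), zero_add]
        exact Finset.sum_congr rfl fun s hs =>
          max_eq_left (sub_nonneg.2 (hge s (Finset.mem_compl.1 hs)))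
    _ ≤ ∑ s ∈ Zᶜ, (y s - k) := by
        rw [Finset.sum_sub_distrib, Finset.sum_sub_distrib]
        linarith
    _ ≤ ∑ s ∈ Zᶜ, max (y s - k) 0 := Finset.sum_le_sum fun s _ => le_max_left _ _
    _ ≤ ∑ s, max (y s - k) 0 :=
        Finset.sum_le_univ_sum_of_nonneg fun s => le_max_right _ _

end Majorization

end DecMin

theorem theorem4p3 {S : Type*} [Fintype S] [DecidableEq S] (B : Set (S → ℝ))
    (hB : DecMin.IsIntegralBasePolyhedron B)
    (xR : S → ℝ) (hxR : xR ∈ B) (hmin : ∀ y ∈ B, DecMin.wBar xR ≤ DecMin.wBar y) :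
    ∃ mZ : S → ℤ, DecMin.IsDecMin (DecMin.integralPoints B) mZ ∧
      ∀ s : S, ⌊xR s⌋ ≤ mZ s ∧ mZ s ≤ ⌈xR s⌉ := by
  rcases hB with rfl | ⟨b, hb, hbi, -, rfl⟩
  · exact absurd hxR (Set.notMem_empty _)
  obtain ⟨z, hz, hbox, htight⟩ := DecMin.exists_integral_rounding hb hbi hxR
  refine ⟨z, ⟨hz, fun y hy => DecMin.not_lex_sortedDecreasing_of_sum_posPart_le fun k => ?_⟩, hbox⟩
  obtain ⟨Z, hZ, hle, hge⟩ := DecMin.exists_isTight_level_set hb hxR hmin k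
  exact DecMin.sum_posPart_le_of_isTight hy hz k (htight Z hZ)
    -- Since `k` is an integer, bounds by `k` on `xR` pass to its ceiling and floor, hence to `z`.
    (fun s hs => (hbox s).2.trans (Int.ceil_le.2 (hle s hs)))
    (fun s hs => (Int.le_floor.2 (hge s hs)).trans (hbox s).1)
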